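/- Let $d\ge 0$ and $r>k\ge 1$ be integers. Let $T(d,r,k)$ denote the smallest positive integer $n$ with the following property: for every list $a_1,\dots,a_n$ of (not necessarily distinct) points in $\mathbb{R}^d$, the index set $\{1,\dots,n\}$ can be partitioned into $r$ disjoint parts $N_1,\dots,N_r$ such that any $k$ of the $r$ convex hulls $\operatorname{conv}\{a_i : i\in N_j\}$ $(j=1,\dots,r)$ have a point in common. Let $T(d,r)=(d+1)(r-1)+1$ be the Tverberg number. If $d<\frac{rk}{r-k}-1$, then $$T(d,r,k)=T(d,r)=(d+1)(r-1)+1 .$$ -/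

import Mathlib

/-- The `n`-point property behind `T(d,r,k)`: every list `a` of `n` points of `ℝ^d` (repetitions
allowed) has an `r`-partition of its index set such that every `k` of the `r` convex hulls of the
parts have a common point. The partition is given by the map `f` sending an index to the label of
its part, so the parts are the fibres of `f`. For `1 ≤ k ≤ r` the parts are automatically nonempty,
because every part belongs to some `k`-tuple and the hull of an empty part is empty. -/
def ReayProperty (d r k n : ℕ) : Prop :=
  ∀ a : Fin n → EuclideanSpace ℝ (Fin d),
    ∃ f : Fin n → Fin r,
      ∀ J : Finset (Fin r), J.card = k →
        (⋂ j ∈ J, convexHull ℝ (a '' {i | f i = j})).Nonempty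

/-- `T(d,r,k)`: the smallest positive integer `n` with the property above. (If there were no such
`n`, the value would be `0`.) -/
noncomputable def reayNumber (d r k : ℕ) : ℕ :=
  sInf {n : ℕ | 0 < n ∧ ReayProperty d r k n}

/-- The Tverberg number `T(d,r) = (d+1)(r-1)+1` (used for `r ≥ 1`). -/
def tverbergNumber (d r : ℕ) : ℕ :=
  (d + 1) * (r - 1) + 1

theorem AlgebraicIndependent.card_le_of_forall_isAlgebraic_adjoin {ι : Type*} [Fintype ι]
    {μ : ι → ℝ} (hμ : AlgebraicIndependent ℚ μ) (s : Finset ℝ)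
    (hs : ∀ l, IsAlgebraic (Algebra.adjoin ℚ (s : Set ℝ)) (μ l)) : Fintype.card ι ≤ s.card := by
  classical
  have hI : (AlgebraicIndependent.matroid ℚ ℝ).Indep (Set.range μ) :=
    AlgebraicIndependent.matroid_indep_iff.2 hμ.to_subtype_range
  have hsub : Set.range μ ⊆ (AlgebraicIndependent.matroid ℚ ℝ).closure (s : Set ℝ) := by
    rintro _ ⟨l, rfl⟩
    rw [AlgebraicIndependent.matroid_closure_eq]
    exact hs l
  have h1 := hI.encard_le_eRk_of_subset hsub
  rw [Matroid.eRk_closure_eq] at h1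
  have h2 := h1.trans (Matroid.eRk_le_encard _ _)
  rw [← Set.image_univ, hμ.injective.injOn.encard_image, Set.encard_univ,
    Set.encard_coe_eq_coe_finsetCard, ENat.card_eq_coe_fintype_card] at h2
  exact_mod_cast h2

theorem exists_algebraicIndependent_pos (n : ℕ) :
    ∃ μ : Fin n → ℝ, AlgebraicIndependent ℚ μ ∧ ∀ l, 0 < μ l := by
  obtain ⟨s, hs⟩ := exists_isTranscendenceBasis ℚ ℝ
  have hinf : Infinite s := by
    by_contra hfin
    have : Countable s := by
      rw [not_infinite_iff_finite] at hfin
      exact Finite.to_countable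
    have halg : Algebra.IsAlgebraic (Algebra.adjoin ℚ s) ℝ := by
      have := hs.isAlgebraic
      rwa [Subtype.range_coe] at this
    have h1 := Algebra.IsAlgebraic.cardinalMk_le_max (Algebra.adjoin ℚ s) ℝ
    have h2 : Cardinal.mk (Algebra.adjoin ℚ s) ≤ Cardinal.aleph0 := by
      have e := hs.1.aevalEquiv.toEquiv.symm
      have : Countable (MvPolynomial s ℚ) := by
        rw [← Cardinal.mk_le_aleph0_iff]
        refine MvPolynomial.cardinalMk_le_max_lift.trans ?_
        simp
      have := e.injective.countable
      rw [Cardinal.mk_le_aleph0_iff]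
      simpa using this
    have h3 := h1.trans (max_le h2 le_rfl)
    rw [Cardinal.mk_real] at h3
    exact absurd Cardinal.aleph0_lt_continuum (not_lt.2 h3)
  let e : Fin n ↪ s := (Fin.valEmbedding).trans (Infinite.natEmbedding s)
  have hx := hs.1.comp e e.injective
  have hsq := hx.polynomial_aeval_of_transcendental (f := fun _ => Polynomial.X ^ 2)
    (fun _ => (Polynomial.transcendental_X ℚ).pow (by norm_num))
  refine ⟨_, hsq, fun l => ?_⟩
  have := hx.ne_zero l
  simp only [map_pow, Polynomial.aeval_X]
  positivity

theorem mem_convexHull_image_fiber_iff {n r : ℕ} {E : Type*} [AddCommGroup E] [Module ℝ E]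
    (a : Fin n → E) (f : Fin n → Fin r) (j : Fin r) (x : E) :
    x ∈ convexHull ℝ (a '' {i | f i = j}) ↔
      ∃ w : Fin n → ℝ, (∀ i, 0 ≤ w i) ∧ ∑ i with f i = j, w i = 1 ∧
        ∑ i with f i = j, w i • a i = x := by
  classical
  constructor
  · intro h
    have key : convexHull ℝ (a '' {i | f i = j}) ⊆ {x | ∃ w : Fin n → ℝ, (∀ i, 0 ≤ w i) ∧
        ∑ i with f i = j, w i = 1 ∧ ∑ i with f i = j, w i • a i = x} := by
      refine convexHull_min ?_ ?_
      · rintro _ ⟨i, hi, rfl⟩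
        refine ⟨Pi.single i 1, fun l => ?_, ?_, ?_⟩
        · by_cases h : l = i
          · subst h; simp
          · simp [h]
        · rw [Finset.sum_eq_single i] <;> simp_all
        · rw [Finset.sum_eq_single i] <;> simp_all
      · rintro _ ⟨w, hw, hw1, rfl⟩ _ ⟨u, hu, hu1, rfl⟩ p q hp hq hpq
        refine ⟨fun i => p * w i + q * u i, fun i => ?_, ?_, ?_⟩
        · have := hw i; have := hu i; positivity
        · rw [Finset.sum_add_distrib, ← Finset.mul_sum, ← Finset.mul_sum, hw1, hu1]; simpa
        · simp only [add_smul, mul_smul, Finset.sum_add_distrib, Finset.smul_sum]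
    exact key h
  · rintro ⟨w, hw, hw1, rfl⟩
    exact (convex_convexHull ℝ _).sum_mem (fun i _ => hw i) hw1
      (fun i hi => subset_convexHull ℝ _ ⟨i, by simpa using hi, rfl⟩)

theorem Finset.sum_powersetCard_prod_le_choose {ι : Type*} [DecidableEq ι] (s : Finset ι)
    (c : ι → ℕ) (k : ℕ) :
    ∑ t ∈ s.powersetCard k, ∏ j ∈ t, c j ≤ (∑ j ∈ s, c j).choose k := by
  induction s using Finset.induction_on generalizing k with
  | empty => cases k <;> simp
  | insert a s ha ih =>
    cases k with
    | zero => simp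
    | succ k =>
      rw [Finset.powersetCard_succ_insert ha, Finset.sum_union, Finset.sum_image,
        Finset.sum_insert ha]
      · have h1 : ∑ t ∈ s.powersetCard k, ∏ j ∈ insert a t, c j =
            c a * ∑ t ∈ s.powersetCard k, ∏ j ∈ t, c j := by
          rw [Finset.mul_sum]
          refine Finset.sum_congr rfl fun t ht => ?_
          rw [Finset.prod_insert fun h => ha ((Finset.mem_powersetCard.1 ht).1 h)]
        rw [h1]
        have h2 : ∀ N m : ℕ, N.choose (k + 1) + m * N.choose k ≤ (m + N).choose (k + 1) := by
          intro N m
          induction m with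
          | zero => simp
          | succ m ihm =>
            have h3 : N.choose k ≤ (m + N).choose k := Nat.choose_le_choose k (by omega)
            have h4 : (m + 1 + N).choose (k + 1) = (m + N).choose k + (m + N).choose (k + 1) := by
              rw [show m + 1 + N = (m + N) + 1 by ring, Nat.choose_succ_succ]
            rw [h4, add_mul]
            omega
        exact (add_le_add (ih _) (Nat.mul_le_mul_left _ (ih _))).trans (h2 _ _)
      · intro t ht u hu htu
        have hat : a ∉ t := fun h => ha ((Finset.mem_powersetCard.1 ht).1 h)
        have hau : a ∉ u := fun h => ha ((Finset.mem_powersetCard.1 hu).1 h)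
        rw [← Finset.erase_insert hat, htu, Finset.erase_insert hau]
      · rw [Finset.disjoint_left]
        intro t ht ht'
        obtain ⟨u, -, rfl⟩ := Finset.mem_image.1 ht'
        exact ha ((Finset.mem_powersetCard.1 ht).1 (Finset.mem_insert_self _ _))

theorem Finset.sum_add_one_le_prod_add_card {ι : Type*} (s : Finset ι) (c : ι → ℕ)
    (hc : ∀ j ∈ s, 1 ≤ c j) : ∑ j ∈ s, c j + 1 ≤ ∏ j ∈ s, c j + s.card := by
  classical
  induction s using Finset.induction_on with
  | empty => simp
  | insert a s ha ih =>
    rw [Finset.sum_insert ha, Finset.prod_insert ha, Finset.card_insert_of_notMem ha]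
    have h1 := ih fun j hj => hc j (Finset.mem_insert_of_mem hj)
    have h2 := hc a (Finset.mem_insert_self _ _)
    have h3 : 1 ≤ ∏ j ∈ s, c j :=
      Finset.one_le_prod' fun j hj => hc j (Finset.mem_insert_of_mem hj)
    nlinarith

open scoped RealInnerProductSpace in
/-- If `p` has minimal norm on the segment from `p` to `q`, then `q` lies on the far side of the
hyperplane through `p` orthogonal to `p`. -/
theorem inner_self_le_inner_of_forall_norm_le {E : Type*} [NormedAddCommGroup E]
    [InnerProductSpace ℝ E] {p q : E}
    (h : ∀ t : ℝ, 0 ≤ t → t ≤ 1 → ‖p‖ ≤ ‖(1 - t) • p + t • q‖) : ⟪p, p⟫ ≤ ⟪q, p⟫ := by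
  by_contra hlt
  push Not at hlt
  set δ := ⟪p, p⟫ - ⟪q, p⟫ with hδ
  have hδ0 : 0 < δ := by rw [hδ]; linarith
  set D := ⟪q - p, q - p⟫ with hD
  have hD0 : 0 ≤ D := real_inner_self_nonneg
  have hexp : ∀ t : ℝ, ⟪(1 - t) • p + t • q, (1 - t) • p + t • q⟫
      = ⟪p, p⟫ - 2 * t * δ + t ^ 2 * D := by
    intro t
    rw [hδ, hD]
    simp only [inner_add_left, inner_add_right, inner_sub_left, inner_sub_right,
      real_inner_smul_left, real_inner_smul_right, real_inner_comm p q]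
    ring
  have hle : ∀ t : ℝ, 0 ≤ t → t ≤ 1 → 2 * t * δ ≤ t ^ 2 * D := by
    intro t h0 h1
    have h2 := h t h0 h1
    have h3 : ‖p‖ ^ 2 ≤ ‖(1 - t) • p + t • q‖ ^ 2 := by gcongr
    rw [← real_inner_self_eq_norm_sq, ← real_inner_self_eq_norm_sq, hexp] at h3
    linarith
  have hpos : 0 < D + δ := by linarith
  have h1 := hle (δ / (D + δ)) (by positivity) ((div_le_one hpos).2 (by linarith))
  rw [div_pow, ← sub_nonneg] at h1
  have h2 : (δ ^ 2 / (D + δ) ^ 2 * D - 2 * (δ / (D + δ)) * δ) * (D + δ) ^ 2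
      = - δ ^ 2 * (D + 2 * δ) := by
    field_simp; ring
  have h3 := mul_nonneg h1 (sq_nonneg (D + δ))
  rw [h2] at h3
  have : 0 < δ ^ 2 * (D + 2 * δ) := by positivity
  linarith

/-- Carathéodory reduction: convex weights on linearly dependent points of an affine hyperplane
missing the origin can be changed, without moving the barycentre, so that one vanishes. -/
theorem exists_stdSimplex_apply_eq_zero {ι E : Type*} [Fintype ι] [AddCommGroup E] [Module ℝ E]
    [FiniteDimensional ℝ E] (hcard : Module.finrank ℝ E < Fintype.card ι) (x : ι → E)
    (φ : E →ₗ[ℝ] ℝ) {m : ℝ} (hm : m ≠ 0) (hφ : ∀ i, φ (x i) = m) {w : ι → ℝ}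
    (hw : w ∈ stdSimplex ℝ ι) :
    ∃ u ∈ stdSimplex ℝ ι, ∑ i, u i • x i = ∑ i, w i • x i ∧ ∃ i, u i = 0 := by
  classical
  have hdep : ¬ LinearIndependent ℝ x := fun h =>
    absurd h.fintype_card_le_finrank (not_le.2 hcard)
  obtain ⟨g, hg, i₁, hi₁⟩ := Fintype.not_linearIndependent_iff.1 hdep
  have hsum : ∑ i, g i = 0 := by
    have := congrArg φ hg
    simp only [map_sum, map_smul, hφ, map_zero, smul_eq_mul, ← Finset.sum_mul] at this
    exact (mul_eq_zero.1 this).resolve_right hm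
  obtain ⟨i₂, -, hi₂⟩ : ∃ i ∈ Finset.univ, 0 < g i :=
    Finset.exists_pos_of_sum_zero_of_exists_nonzero g hsum ⟨i₁, Finset.mem_univ _, hi₁⟩
  obtain ⟨i₀, hi₀, hmin⟩ := Finset.exists_min_image {i | 0 < g i} (fun i => w i / g i)
    ⟨i₂, by simpa using hi₂⟩
  have hg0 : 0 < g i₀ := by simpa using hi₀
  refine ⟨fun i => w i - w i₀ / g i₀ * g i, ⟨fun i => ?_, ?_⟩, ?_, i₀, ?_⟩
  · rcases lt_or_ge 0 (g i) with h | h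
    · have := hmin i (by simpa using h)
      rw [le_div_iff₀ h] at this
      linarith
    · have := hw.1 i
      have := mul_nonneg (div_nonneg (hw.1 i₀) hg0.le) (neg_nonneg.2 h)
      linarith
  · rw [Finset.sum_sub_distrib, ← Finset.mul_sum, hsum, hw.2]; simp
  · simp only [sub_smul, mul_smul, Finset.sum_sub_distrib, ← Finset.smul_sum, hg]; simp
  · simp [hg0.ne']

open scoped RealInnerProductSpace in
/-- **Colourful Carathéodory theorem**, for cones at the origin: if no colour class lies in an open
half-space, then some rainbow choice has the origin in its convex hull. -/
theorem exists_rainbow_sum_eq_zero {ι κ E : Type*} [Fintype ι] [Finite κ]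
    [NormedAddCommGroup E] [InnerProductSpace ℝ E] [FiniteDimensional ℝ E]
    (hcard : Module.finrank ℝ E < Fintype.card ι) (x : ι → κ → E)
    (hx : ∀ i v, ∃ j, ⟪x i j, v⟫ ≤ 0) :
    ∃ f : ι → κ, ∃ w ∈ stdSimplex ℝ ι, ∑ i, w i • x i (f i) = 0 := by
  classical
  have hι : Nonempty ι := Fintype.card_pos_iff.1 (by omega)
  have hne : (stdSimplex ℝ ι).Nonempty := ⟨_, single_mem_stdSimplex ℝ hι.some⟩
  have hmin : ∀ f : ι → κ, ∃ w ∈ stdSimplex ℝ ι, ∀ u ∈ stdSimplex ℝ ι,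
      ‖∑ i, w i • x i (f i)‖ ≤ ‖∑ i, u i • x i (f i)‖ := by
    intro f
    obtain ⟨w, hw, h⟩ := (isCompact_stdSimplex ℝ ι).exists_isMinOn hne
      (f := fun w : ι → ℝ => ‖∑ i, w i • x i (f i)‖) (by fun_prop)
    exact ⟨w, hw, fun u hu => h hu⟩
  choose W hW hWmin using hmin
  have : Nonempty (ι → κ) := ⟨fun i => (hx i 0).choose⟩
  obtain ⟨f, hf⟩ := Finite.exists_min fun f : ι → κ => ‖∑ i, W f i • x i (f i)‖
  have hbest : ∀ g : ι → κ, ∀ u ∈ stdSimplex ℝ ι,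
      ‖∑ i, W f i • x i (f i)‖ ≤ ‖∑ i, u i • x i (g i)‖ :=
    fun g u hu => (hf g).trans (hWmin g u hu)
  set p := ∑ i, W f i • x i (f i) with hp
  refine ⟨f, W f, hW f, ?_⟩
  by_contra hp0
  rw [← hp] at hp0
  have hpp : 0 < ⟪p, p⟫ := real_inner_self_pos.2 hp0
  have hfar : ∀ (g : ι → κ), ∀ u ∈ stdSimplex ℝ ι, ∑ i, u i • x i (g i) = p →
      ∀ i, ⟪p, p⟫ ≤ ⟪x i (g i), p⟫ := by
    intro g u hu hup i
    refine inner_self_le_inner_of_forall_norm_le fun t h0 h1 => ?_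
    have hmem := convex_stdSimplex ℝ ι hu (single_mem_stdSimplex ℝ i) (sub_nonneg.2 h1) h0
      (by ring)
    convert hbest g _ hmem using 2
    simp [add_smul, mul_smul, Finset.sum_add_distrib, ← Finset.smul_sum, hup, Pi.single_apply]
  obtain ⟨u, hu, hup, i₀, hi₀⟩ : ∃ u ∈ stdSimplex ℝ ι,
      ∑ i, u i • x i (f i) = p ∧ ∃ i, u i = 0 := by
    by_cases h0 : ∃ i, W f i = 0
    · exact ⟨W f, hW f, hp.symm, h0⟩
    · push Not at h0
      refine exists_stdSimplex_apply_eq_zero hcard (fun i => x i (f i)) (innerₛₗ ℝ p) hpp.ne'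
        (fun i => ?_) (hW f)
      have hsum : ∑ i, W f i * (⟪x i (f i), p⟫ - ⟪p, p⟫) = 0 := by
        simp only [mul_sub, Finset.sum_sub_distrib, ← Finset.sum_mul, (hW f).2]
        have : ⟪p, p⟫ = ∑ i, W f i * ⟪x i (f i), p⟫ := by
          conv_lhs => rw [hp, sum_inner]
          simp [real_inner_smul_left, hp]
        linarith
      rw [Finset.sum_eq_zero_iff_of_nonneg fun i _ =>
        mul_nonneg ((hW f).1 i) (sub_nonneg.2 (hfar f _ (hW f) hp.symm i))] at hsum
      have := (mul_eq_zero.1 (hsum i (Finset.mem_univ _))).resolve_left (h0 i)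
      simp only [innerₛₗ_apply_apply, real_inner_comm _ p]
      linarith
  obtain ⟨j, hj⟩ := hx i₀ p
  have hup' : ∑ i, u i • x i (Function.update f i₀ j i) = p := by
    rw [← hup]
    refine Finset.sum_congr rfl fun i _ => ?_
    by_cases h : i = i₀
    · subst h; simp [hi₀]
    · simp [h]
  have := hfar _ u hu hup' i₀
  simp only [Function.update_self] at this
  linarith

/-- **Tverberg's theorem.** -/
theorem exists_tverberg_partition {d s n : ℕ} (hn : (d + 1) * s < n)
    (a : Fin n → EuclideanSpace ℝ (Fin d)) :
    ∃ f : Fin n → Fin (s + 1),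
      (⋂ j, convexHull ℝ (a '' {i | f i = j})).Nonempty := by
  classical
  let b : Fin n → Option (Fin d) → ℝ := fun i c => c.elim 1 (fun c => a i c)
  let W : Fin (s + 1) → Fin s → ℝ := fun j l => (if j = l.castSucc then 1 else 0) -
    if j = Fin.last s then 1 else 0
  let x : Fin n → Fin (s + 1) → EuclideanSpace ℝ (Option (Fin d) × Fin s) :=
    fun i j => WithLp.toLp 2 fun q => b i q.1 * W j q.2
  have hW : ∀ l, ∑ j, W j l = 0 := fun l => by simp [W, Finset.sum_sub_distrib]
  have hx0 : ∀ i, ∑ j, x i j = 0 := by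
    intro i
    ext q
    simp [x, ← Finset.mul_sum, hW]
  obtain ⟨f, w, hw, hsum⟩ := exists_rainbow_sum_eq_zero (ι := Fin n) (by simpa using hn) x
    (fun i v => by
      by_contra! h
      have h1 : 0 < ∑ j, inner ℝ (x i j) v := Finset.sum_pos (fun j _ => h j) Finset.univ_nonempty
      rw [← sum_inner, hx0, inner_zero_left] at h1
      exact lt_irrefl _ h1)
  let B : Fin (s + 1) → Option (Fin d) → ℝ := fun j c => ∑ i with f i = j, w i * b i c
  have hB : ∀ j c, B j c = B (Fin.last s) c := by
    intro j c
    induction j using Fin.lastCases with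
    | last => rfl
    | cast l =>
      have h := congrArg (fun v : EuclideanSpace ℝ (Option (Fin d) × Fin s) => v (c, l)) hsum
      simp only [x, W, WithLp.ofLp_sum, WithLp.ofLp_smul, Finset.sum_apply, Pi.smul_apply,
        smul_eq_mul, mul_sub, mul_ite, mul_one, mul_zero, Finset.sum_sub_distrib,
        WithLp.ofLp_zero, Pi.zero_apply, ← Finset.sum_filter] at h
      exact sub_eq_zero.1 h
  have hmass : ((s : ℝ) + 1) * B (Fin.last s) none = 1 := by
    have h1 : ∑ j, B j none = 1 := by
      simp only [B, b, Option.elim_none, mul_one]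
      rw [Finset.sum_fiberwise]
      exact hw.2
    simpa [hB] using h1
  refine ⟨f, ∑ i with f i = Fin.last s, (((s : ℝ) + 1) * w i) • a i,
    Set.mem_iInter.2 fun j => ?_⟩
  rw [mem_convexHull_image_fiber_iff]
  refine ⟨fun i => ((s : ℝ) + 1) * w i, fun i => mul_nonneg (by positivity) (hw.1 i), ?_, ?_⟩
  · have := hB j none
    simp only [B, b, Option.elim_none, mul_one] at this hmass
    rw [← Finset.mul_sum, this, hmass]
  · ext c
    have := hB j (some c)
    simp only [B, b, Option.elim_some] at this
    simp [mul_assoc, ← Finset.mul_sum, this]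

/-- The directions `e₁, …, e_d, -(e₁ + ⋯ + e_d)` of the vertices of a simplex around the origin. -/
noncomputable def simplexDirection (d : ℕ) (i : Fin (d + 1)) : EuclideanSpace ℝ (Fin d) :=
  WithLp.toLp 2 fun c => (if i = c.castSucc then 1 else 0) - if i = Fin.last d then 1 else 0

theorem sum_smul_simplexDirection_apply {d : ℕ} (z : Fin (d + 1) → ℝ) (c : Fin d) :
    (∑ i, z i • simplexDirection d i) c = z c.castSucc - z (Fin.last d) := by
  simp [simplexDirection, mul_sub, Finset.sum_sub_distrib]

/-- Coordinates with respect to the simplicial fan spanned by the `simplexDirection`s are unique. -/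
theorem eq_of_sum_smul_simplexDirection_eq {d : ℕ} {z z' : Fin (d + 1) → ℝ} (hz : ∀ i, 0 ≤ z i)
    (hz' : ∀ i, 0 ≤ z' i) (h0 : ∃ i, z i = 0) (h0' : ∃ i, z' i = 0)
    (h : ∑ i, z i • simplexDirection d i = ∑ i, z' i • simplexDirection d i) : z = z' := by
  have hδ : ∀ i, z i - z' i = z (Fin.last d) - z' (Fin.last d) := by
    intro i
    induction i using Fin.lastCases with
    | last => rfl
    | cast c =>
      have := congrArg (fun v : EuclideanSpace ℝ (Fin d) => v c) h
      simp only [sum_smul_simplexDirection_apply] at this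
      linarith
  obtain ⟨i, hi⟩ := h0
  obtain ⟨i', hi'⟩ := h0'
  have h1 := hδ i
  have h2 := hδ i'
  have h3 := hz i'
  have h4 := hz' i
  funext l
  have h5 := hδ l
  linarith

/-- A system of equations over `ℚ(μ)` with `μ` algebraically independent forces enough free
variables: if the colour sums of `y` agree over all parts in `K`, `y` is supported on the colours
`S`, and each part satisfies `∑ μ y = 1`, then the parts in `K` have many points of colour in `S`. -/
theorem card_le_of_algebraicIndependent_weights {n : ℕ} {κ χ : Type*} [DecidableEq κ]
    [DecidableEq χ] {μ : Fin n → ℝ} (hμ : AlgebraicIndependent ℚ μ) (f : Fin n → κ)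
    (col : Fin n → χ) (K : Finset κ) (S : Finset χ)
    (hS : ∀ i ∈ S, ∀ j ∈ K, ∃ l, f l = j ∧ col l = i) (y : Fin n → ℝ)
    (hy0 : ∀ l, f l ∈ K → col l ∉ S → y l = 0)
    (hcol : ∀ i ∈ S, ∀ j ∈ K, ∀ j' ∈ K,
      ∑ l with f l = j ∧ col l = i, y l = ∑ l with f l = j' ∧ col l = i, y l)
    (hone : ∀ j ∈ K, ∑ l with f l = j, μ l * y l = 1) :
    S.card * (K.card - 1) + K.card ≤ (Finset.univ.filter fun l => f l ∈ K ∧ col l ∈ S).card := by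
  classical
  rcases K.eq_empty_or_nonempty with rfl | ⟨j₀, hj₀⟩
  · simp
  obtain ⟨l₀, -⟩ : ∃ l, f l = j₀ := by
    by_contra! h
    have := hone j₀ hj₀
    simp [h] at this
  have hrep : ∀ q : χ × κ, ∃ l, q ∈ S ×ˢ K.erase j₀ → f l = q.2 ∧ col l = q.1 := by
    intro q
    by_cases hq : q ∈ S ×ˢ K.erase j₀
    · obtain ⟨h1, h2⟩ := Finset.mem_product.1 hq
      obtain ⟨l, hl⟩ := hS _ h1 _ (Finset.mem_of_mem_erase h2)
      exact ⟨l, fun _ => hl⟩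
    · exact ⟨l₀, fun h => absurd h hq⟩
  choose rep hrep using hrep
  have hpiv : ∀ j, ∃ l, j ∈ K → f l = j ∧ y l ≠ 0 := by
    intro j
    by_cases hj : j ∈ K
    · by_contra! h
      have h1 := hone j hj
      rw [Finset.sum_eq_zero] at h1
      · exact zero_ne_one h1
      · intro l hl
        rw [(h l).2 (Finset.mem_filter.1 hl).2, mul_zero]
    · exact ⟨l₀, fun h => absurd h hj⟩
  choose piv hpiv using hpiv
  set P := Finset.univ.filter fun l => f l ∈ K ∧ col l ∈ S with hP
  set R := (S ×ˢ K.erase j₀).image rep with hR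
  have hRcard : R.card = S.card * (K.card - 1) := by
    rw [hR, Finset.card_image_of_injOn, Finset.card_product, Finset.card_erase_of_mem hj₀]
    intro q hq q' hq' h
    have h1 := hrep q hq
    have h2 := hrep q' hq'
    rw [h] at h1
    exact Prod.ext (h1.2.symm.trans h2.2) (h1.1.symm.trans h2.1)
  have hRP : R ⊆ P := by
    intro l hl
    obtain ⟨q, hq, rfl⟩ := Finset.mem_image.1 hl
    obtain ⟨h1, h2⟩ := Finset.mem_product.1 hq
    rw [hP, Finset.mem_filter, (hrep q hq).1, (hrep q hq).2]
    exact ⟨Finset.mem_univ _, Finset.mem_of_mem_erase h2, h1⟩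
  set M := K.image piv with hM
  have hMcard : M.card = K.card := by
    refine Finset.card_image_of_injOn fun j hj j' hj' h => ?_
    rw [← (hpiv j hj).1, ← (hpiv j' hj').1, h]
  set T := (P \ R).image y ∪ Mᶜ.image μ with hT
  set A := Subalgebra.algebraicClosure (Algebra.adjoin ℚ (T : Set ℝ)) ℝ with hA
  have hTA : ∀ t ∈ T, t ∈ A := fun t ht =>
    isAlgebraic_algebraMap (⟨t, Algebra.subset_adjoin ht⟩ : Algebra.adjoin ℚ (T : Set ℝ))
  have hyfree : ∀ l ∉ R, f l ∈ K → y l ∈ A := by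
    intro l hl hlK
    by_cases hlS : col l ∈ S
    · refine hTA _ (Finset.mem_union_left _ (Finset.mem_image_of_mem _ ?_))
      simp [hP, hl, hlK, hlS]
    · rw [hy0 l hlK hlS]; exact A.zero_mem
  have hyA : ∀ l, f l ∈ K → y l ∈ A := by
    intro l hlK
    by_cases hl : l ∈ R
    · obtain ⟨q, hq, rfl⟩ := Finset.mem_image.1 hl
      obtain ⟨h1, h2⟩ := Finset.mem_product.1 hq
      have h3 := hcol q.1 h1 q.2 (Finset.mem_of_mem_erase h2) j₀ hj₀
      rw [← Finset.add_sum_erase _ _ (a := rep q) (by simp [hrep q hq])] at h3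
      rw [eq_sub_of_add_eq h3]
      refine A.sub_mem (A.sum_mem fun l hl => ?_) (A.sum_mem fun l hl => ?_)
      · have hl' := (Finset.mem_filter.1 hl).2
        refine hyfree l (fun hlR => ?_) (hl'.1 ▸ hj₀)
        obtain ⟨q', hq', rfl⟩ := Finset.mem_image.1 hlR
        have := (Finset.mem_product.1 hq').2
        rw [← (hrep q' hq').1, hl'.1] at this
        simp at this
      · obtain ⟨hne, hl⟩ := Finset.mem_erase.1 hl
        have hl' := (Finset.mem_filter.1 hl).2
        refine hyfree l (fun hlR => ?_) (hl'.1 ▸ Finset.mem_of_mem_erase h2)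
        obtain ⟨q', hq', rfl⟩ := Finset.mem_image.1 hlR
        rw [(hrep q' hq').1, (hrep q' hq').2] at hl'
        exact hne (congrArg rep (Prod.ext hl'.2 hl'.1))
    · exact hyfree l hl hlK
  have hμA : ∀ l, μ l ∈ A := by
    intro l
    by_cases hl : l ∈ M
    · obtain ⟨j, hj, rfl⟩ := Finset.mem_image.1 hl
      have h1 := hone j hj
      rw [← Finset.add_sum_erase _ _ (a := piv j) (by simp [hpiv j hj])] at h1
      rw [eq_div_of_mul_eq (hpiv j hj).2 (eq_sub_of_add_eq h1), div_eq_mul_inv]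
      refine A.mul_mem (A.sub_mem A.one_mem (A.sum_mem fun l hl => ?_)) ?_
      · obtain ⟨hne, hl⟩ := Finset.mem_erase.1 hl
        have hl' := (Finset.mem_filter.1 hl).2
        refine A.mul_mem (hTA _ (Finset.mem_union_right _ (Finset.mem_image_of_mem _ ?_)))
          (hyA l (hl' ▸ hj))
        rw [Finset.mem_compl]
        intro hlM
        obtain ⟨j', hj', rfl⟩ := Finset.mem_image.1 hlM
        rw [(hpiv j' hj').1] at hl'
        exact hne (congrArg piv hl')
      · exact IsAlgebraic.inv (hyA (piv j) ((hpiv j hj).1.symm ▸ hj))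
    · exact hTA _ (Finset.mem_union_right _ (Finset.mem_image_of_mem _ (by simpa using hl)))
  have h1 := hμ.card_le_of_forall_isAlgebraic_adjoin T hμA
  have h2 : T.card ≤ (P.card - R.card) + (n - M.card) := by
    refine (Finset.card_union_le _ _).trans (add_le_add ?_ ?_)
    · rw [← Finset.card_sdiff_of_subset hRP]; exact Finset.card_image_le
    · refine Finset.card_image_le.trans ?_
      rw [Finset.card_compl, Fintype.card_fin]
  have h3 := Finset.card_le_card hRP
  have h4 : M.card ≤ n := by simpa using Finset.card_le_univ M
  rw [Fintype.card_fin] at h1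
  rw [← hRcard]
  omega

/-- Points on the rays of a simplicial fan at algebraically independent inverse distances: if the
hulls of the parts in `K`, none of which meets all rays, have a common point, then these parts have
many points on the rays which all of them meet. -/
theorem card_le_of_mem_convexHull_rays {n d r : ℕ} {μ : Fin n → ℝ}
    (hμ : AlgebraicIndependent ℚ μ) (hpos : ∀ l, 0 < μ l) (f : Fin n → Fin r)
    (col : Fin n → Fin (d + 1)) (K : Finset (Fin r))
    (hK : ∀ j ∈ K, ∃ i, ∀ l, f l = j → col l ≠ i) (x : EuclideanSpace ℝ (Fin d))
    (hx : ∀ j ∈ K, x ∈ convexHull ℝ ((fun l => (μ l)⁻¹ • simplexDirection d (col l)) ''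
      {l | f l = j})) (S : Finset (Fin (d + 1)))
    (hS : ∀ i, i ∈ S ↔ ∀ j ∈ K, ∃ l, f l = j ∧ col l = i) :
    S.card * (K.card - 1) + K.card ≤ (Finset.univ.filter fun l => f l ∈ K ∧ col l ∈ S).card := by
  classical
  have hw : ∀ j, ∃ w : Fin n → ℝ, j ∈ K → (∀ i, 0 ≤ w i) ∧ ∑ i with f i = j, w i = 1 ∧
      ∑ i with f i = j, w i • (μ i)⁻¹ • simplexDirection d (col i) = x := by
    intro j
    by_cases hj : j ∈ K
    · obtain ⟨w, hw⟩ := (mem_convexHull_image_fiber_iff _ f j x).1 (hx j hj)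
      exact ⟨w, fun _ => hw⟩
    · exact ⟨0, fun h => absurd h hj⟩
  choose w hw using hw
  set y : Fin n → ℝ := fun l => w (f l) l * (μ l)⁻¹ with hy
  have hynn : ∀ l, f l ∈ K → 0 ≤ y l := fun l hl =>
    mul_nonneg ((hw _ hl).1 l) (inv_nonneg.2 (hpos l).le)
  set z : Fin r → Fin (d + 1) → ℝ := fun j i => ∑ l with f l = j ∧ col l = i, y l with hz
  have hznn : ∀ j ∈ K, ∀ i, 0 ≤ z j i := fun j hj i => Finset.sum_nonneg fun l hl =>
    hynn l ((Finset.mem_filter.1 hl).2.1 ▸ hj)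
  have hz0 : ∀ j i, (∀ l, f l = j → col l ≠ i) → z j i = 0 := by
    intro j i h
    rw [hz]
    refine Finset.sum_eq_zero fun l hl => ?_
    exact absurd (Finset.mem_filter.1 hl).2.2 (h l (Finset.mem_filter.1 hl).2.1)
  have hzx : ∀ j ∈ K, ∑ i, z j i • simplexDirection d i = x := by
    intro j hj
    rw [← (hw j hj).2.2, ← Finset.sum_fiberwise _ col]
    refine Finset.sum_congr rfl fun i _ => ?_
    rw [hz, Finset.sum_smul, Finset.filter_filter]
    refine Finset.sum_congr rfl fun l hl => ?_
    obtain ⟨rfl, rfl⟩ := (Finset.mem_filter.1 hl).2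
    rw [hy, mul_smul]
  have hzeq : ∀ j ∈ K, ∀ j' ∈ K, z j = z j' := by
    intro j hj j' hj'
    obtain ⟨i, hi⟩ := hK j hj
    obtain ⟨i', hi'⟩ := hK j' hj'
    exact eq_of_sum_smul_simplexDirection_eq (hznn j hj) (hznn j' hj') ⟨i, hz0 j i hi⟩
      ⟨i', hz0 j' i' hi'⟩ ((hzx j hj).trans (hzx j' hj').symm)
  refine card_le_of_algebraicIndependent_weights hμ f col K S (fun i hi => (hS i).1 hi) y
    (fun l hlK hlS => ?_) (fun i _ j hj j' hj' => congrFun (hzeq j hj j' hj') i) (fun j hj => ?_)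
  · rw [hS] at hlS
    push Not at hlS
    obtain ⟨j, hj, hjl⟩ := hlS
    have h1 : z (f l) (col l) = 0 := by rw [hzeq _ hlK j hj]; exact hz0 _ _ hjl
    rw [hz, Finset.sum_eq_zero_iff_of_nonneg
      fun l' hl' => hynn l' (by rw [(Finset.mem_filter.1 hl').2.1]; exact hlK)] at h1
    exact h1 l (by simp)
  · rw [← (hw j hj).2.1]
    refine Finset.sum_congr rfl fun l hl => ?_
    obtain rfl := (Finset.mem_filter.1 hl).2
    have := (hpos l).ne'
    rw [hy]
    field_simp

/-- Double counting over `k`-sets: some `K` carries few monochromatic transversals. -/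
theorem exists_powersetCard_sum_prod_lt {ι χ : Type*} [Fintype χ] (N : Finset ι)
    (c : χ → ι → ℕ) {k b : ℕ} (hc : ∀ i, ∑ j ∈ N, c i j + 1 ≤ N.card) (hkN : k < N.card)
    (hNb : N.card ≤ b) (hb : Fintype.card χ * (b - k) < b * k) :
    ∃ K ∈ N.powersetCard k, ∑ i, ∏ j ∈ K, c i j < k := by
  classical
  by_contra! h
  obtain ⟨p, hp⟩ : ∃ p, N.card = p + 1 := ⟨N.card - 1, by omega⟩
  have h1 : (p + 1).choose k * k ≤ Fintype.card χ * p.choose k := by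
    have h2 := Finset.card_nsmul_le_sum _ _ _ h
    rw [Finset.card_powersetCard, hp, smul_eq_mul, Finset.sum_comm] at h2
    refine h2.trans ?_
    have h3 : ∀ i ∈ (Finset.univ : Finset χ),
        ∑ K ∈ N.powersetCard k, ∏ j ∈ K, c i j ≤ p.choose k := fun i _ =>
      (N.sum_powersetCard_prod_le_choose (c i) k).trans
        (Nat.choose_le_choose k (by have := hc i; omega))
    simpa using Finset.sum_le_card_nsmul _ _ _ h3
  have h4 := Nat.choose_mul_succ_eq p k
  have h5 : 0 < (p + 1).choose k := Nat.choose_pos (by omega)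
  have h6 : (p + 1) * k ≤ Fintype.card χ * (p + 1 - k) := by
    refine Nat.le_of_mul_le_mul_left ?_ h5
    calc (p + 1).choose k * ((p + 1) * k) = ((p + 1).choose k * k) * (p + 1) := by ring
      _ ≤ (Fintype.card χ * p.choose k) * (p + 1) := Nat.mul_le_mul_right _ h1
      _ = (p + 1).choose k * (Fintype.card χ * (p + 1 - k)) := by rw [mul_assoc, h4]; ring
  obtain ⟨u, hu⟩ : ∃ u, p + 1 = k + u := ⟨p + 1 - k, by omega⟩
  obtain ⟨v, rfl⟩ : ∃ v, b = k + u + v := ⟨b - (k + u), by omega⟩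
  rw [hu, Nat.add_sub_cancel_left] at h6
  rw [show k + u + v - k = u + v by omega] at hb
  have h7 : k * u ≤ Fintype.card χ * u := by nlinarith [Nat.zero_le (k * k)]
  have h8 := Nat.le_of_mul_le_mul_right h7 (by omega)
  nlinarith [Nat.mul_le_mul_right v h8]

theorem not_reayProperty {d s k n : ℕ} (hks : k < s + 1)
    (hd : (d + 1) * (s + 1 - k) < (s + 1) * k) (hn : n ≤ (d + 1) * s) :
    ¬ ReayProperty d (s + 1) k n := by
  classical
  intro H
  obtain ⟨μ, hμ, hpos⟩ := exists_algebraicIndependent_pos n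
  obtain ⟨col, hfib⟩ : ∃ col : Fin n → Fin (d + 1),
      ∀ i, (Finset.univ.filter fun l => col l = i).card ≤ s := by
    refine ⟨fun l => (finProdFinEquiv.symm (Fin.castLE hn l)).1, fun i => ?_⟩
    refine le_of_le_of_eq (?_ : _ ≤ (Finset.univ : Finset (Fin s)).card) (by simp)
    refine Finset.card_le_card_of_injOn (fun l => (finProdFinEquiv.symm (Fin.castLE hn l)).2)
      (fun _ _ => Finset.mem_coe.2 (Finset.mem_univ _)) fun l hl l' hl' h => ?_
    have h1 := (Finset.mem_filter.1 hl).2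
    have h2 := (Finset.mem_filter.1 hl').2
    exact Fin.castLE_injective hn (finProdFinEquiv.symm.injective
      (Prod.ext (h1.trans h2.symm) h))
  obtain ⟨f, hf⟩ := H fun l => (μ l)⁻¹ • simplexDirection d (col l)
  set c : Fin (d + 1) → Fin (s + 1) → ℕ := fun i j =>
    (Finset.univ.filter fun l => f l = j ∧ col l = i).card with hc
  have hcpos : ∀ i j, 1 ≤ c i j ↔ ∃ l, f l = j ∧ col l = i := by
    intro i j
    simp [hc, Nat.one_le_iff_ne_zero, Finset.card_eq_zero, Finset.filter_eq_empty_iff]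
  set N : Finset (Fin (s + 1)) := Finset.univ.filter fun j => ∃ i, ∀ l, f l = j → col l ≠ i
    with hN
  have hsum : ∀ i (K : Finset (Fin (s + 1))),
      ∑ j ∈ K, c i j = (Finset.univ.filter fun l => f l ∈ K ∧ col l = i).card := by
    intro i K
    rw [Finset.card_eq_sum_card_fiberwise (f := f) (t := K)
      fun l hl => (Finset.mem_filter.1 hl).2.1]
    refine Finset.sum_congr rfl fun j hj => ?_
    rw [hc, Finset.filter_filter]
    refine congrArg Finset.card (Finset.ext fun l => ?_)
    simp only [Finset.mem_filter, Finset.mem_univ, true_and]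
    constructor
    · rintro ⟨rfl, h⟩; exact ⟨⟨hj, h⟩, rfl⟩
    · rintro ⟨⟨-, h⟩, rfl⟩; exact ⟨rfl, h⟩
  have hcN : ∀ i, ∑ j ∈ N, c i j + 1 ≤ N.card := by
    intro i
    have h1 : ∑ j, c i j ≤ s := by
      rw [hsum]; simpa using hfib i
    rw [← Finset.sum_add_sum_compl N] at h1
    have h2 : Nᶜ.card • 1 ≤ ∑ j ∈ Nᶜ, c i j := by
      refine Finset.card_nsmul_le_sum _ _ _ fun j hj => (hcpos i j).2 ?_
      by_contra! h
      exact Finset.mem_compl.1 hj (Finset.mem_filter.2 ⟨Finset.mem_univ _, i, h⟩)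
    rw [Finset.card_compl, Fintype.card_fin, smul_eq_mul, mul_one] at h2
    omega
  obtain ⟨K, hKN, hKk, hK⟩ : ∃ K ⊆ N, K.card ≤ k ∧ ∑ i, ∏ j ∈ K, c i j < K.card := by
    rcases le_or_gt N.card k with h | h
    · refine ⟨N, subset_rfl, h, ?_⟩
      rw [Finset.sum_eq_zero]
      · have := hcN 0; omega
      · intro i _
        by_contra h0
        have h1 : N.card • 1 ≤ ∑ j ∈ N, c i j := Finset.card_nsmul_le_sum _ _ _ fun j hj =>
          Nat.one_le_iff_ne_zero.2 (Finset.prod_ne_zero_iff.1 h0 j hj)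
        have := hcN i
        simp only [smul_eq_mul, mul_one] at h1
        omega
    · obtain ⟨K, hK, hlt⟩ := exists_powersetCard_sum_prod_lt N c hcN h
        (by simpa using Finset.card_le_univ N) (by simpa using hd)
      obtain ⟨h1, h2⟩ := Finset.mem_powersetCard.1 hK
      exact ⟨K, h1, h2.le, h2.symm ▸ hlt⟩
  obtain ⟨J, hKJ, -, hJ⟩ := Finset.exists_subsuperset_card_eq (Finset.subset_univ K) hKk
    (by simpa using hks.le)
  obtain ⟨x, hx⟩ := hf J hJ
  rw [Set.mem_iInter₂] at hx
  set S : Finset (Fin (d + 1)) := Finset.univ.filter fun i => ∀ j ∈ K, ∃ l, f l = j ∧ col l = i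
    with hS
  have h1 := card_le_of_mem_convexHull_rays hμ hpos f col K
    (fun j hj => (Finset.mem_filter.1 (hKN hj)).2) x (fun j hj => hx j (hKJ hj)) S
    (fun i => by simp [hS])
  have h2 : (Finset.univ.filter fun l => f l ∈ K ∧ col l ∈ S).card
      = ∑ i ∈ S, ∑ j ∈ K, c i j := by
    rw [Finset.card_eq_sum_card_fiberwise (f := col) (t := S)
      fun l hl => (Finset.mem_filter.1 hl).2.2]
    refine Finset.sum_congr rfl fun i hi => ?_
    rw [hsum, Finset.filter_filter]
    refine congrArg Finset.card (Finset.ext fun l => ?_)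
    simp only [Finset.mem_filter, Finset.mem_univ, true_and]
    constructor
    · rintro ⟨⟨h, -⟩, rfl⟩; exact ⟨h, rfl⟩
    · rintro ⟨h, rfl⟩; exact ⟨⟨h, hi⟩, rfl⟩
  have h3 : ∑ i ∈ S, (∑ j ∈ K, c i j + 1) ≤ ∑ i ∈ S, (∏ j ∈ K, c i j + K.card) :=
    Finset.sum_le_sum fun i hi => K.sum_add_one_le_prod_add_card _ fun j hj =>
      (hcpos i j).2 ((Finset.mem_filter.1 hi).2 j hj)
  have h4 : ∑ i ∈ S, ∏ j ∈ K, c i j ≤ ∑ i, ∏ j ∈ K, c i j :=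
    Finset.sum_le_sum_of_subset (Finset.subset_univ S)
  simp only [Finset.sum_add_distrib, Finset.sum_const, smul_eq_mul, mul_one] at h3
  obtain ⟨q, hq⟩ : ∃ q, K.card = q + 1 := ⟨K.card - 1, by omega⟩
  rw [hq, Nat.mul_add, mul_one] at h3
  rw [hq, Nat.add_sub_cancel] at h1
  omega

theorem theorem4 (d r k : ℕ) (hkr : k < r)
    (hd : (d : ℝ) < (r : ℝ) * (k : ℝ) / ((r : ℝ) - (k : ℝ)) - 1) :
    reayNumber d r k = tverbergNumber d r ∧
      tverbergNumber d r = (d + 1) * (r - 1) + 1 := by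
  refine ⟨?_, rfl⟩
  obtain ⟨s, rfl⟩ : ∃ s, r = s + 1 := ⟨r - 1, by omega⟩
  have hd' : (d + 1) * (s + 1 - k) < (s + 1) * k := by
    have h1 : (0 : ℝ) < ((s + 1 : ℕ) : ℝ) - k := sub_pos.2 (by exact_mod_cast hkr)
    rw [lt_sub_iff_add_lt, lt_div_iff₀ h1] at hd
    rw [← Nat.cast_sub hkr.le] at hd
    exact_mod_cast hd
  have hT : tverbergNumber d (s + 1) = (d + 1) * s + 1 := rfl
  rw [hT]
  refine IsLeast.csInf_eq ⟨⟨Nat.succ_pos _, fun a => ?_⟩, fun n hn => ?_⟩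
  · obtain ⟨f, hf⟩ := exists_tverberg_partition (Nat.lt_succ_self ((d + 1) * s)) a
    exact ⟨f, fun J _ => hf.mono fun x hx => Set.mem_iInter₂.2 fun j _ => Set.mem_iInter.1 hx j⟩
  · by_contra! h
    exact not_reayProperty hkr hd' (Nat.lt_succ_iff.1 h) hn.2
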